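/- Let $G$ be a finite simple undirected graph with vertex set $V(G)$, $|V(G)|=n$, and let $d_G(v)$ denote the degree of the vertex $v$. Let $\mathcal M(G)$ be the set of all matchings of $G$ (sets of edges of which no two distinct ones share an endpoint), the empty matching included, and for $M\in\mathcal M(G)$ let $V(M)$ be the set of endpoints of the edges in $M$. The Laplacian matching polynomial of $G$ is $$\beta(G,x)=\sum_{M\in\mathcal M(G)}(-1)^{|M|}\prod_{v\in V(G)\setminus V(M)}\bigl(x-d_G(v)\bigr).$$ Then $\beta(G,x)$ has $n$ zeros, counted with multiplicity, all of them real, and the sequence of these zeros majorizes the degree sequence of $G$. That is, if $z_1\ge z_2\ge\cdots\ge z_n$ are the zeros of $\beta(G,x)$, repeated according to multiplicity, and $d_1\ge d_2\ge\cdots\ge d_n$ are the degrees of the vertices of $G$, then $$\sum_{i=1}^k d_i\le\sum_{i=1}^k z_i\quad\text{for } k=1,\ldots,n,\qquad\text{and}\qquad \sum_{i=1}^n d_i=\sum_{i=1}^n z_i.$$ -/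

import Mathlib

/-- A matching of `G`: a (possibly empty) set `M` of edges of `G` such that no two distinct
edges of `M` share an endpoint. -/
def IsEdgeMatching {V : Type*} (G : SimpleGraph V) (M : Finset (Sym2 V)) : Prop :=
  (∀ e ∈ M, e ∈ G.edgeSet) ∧ ∀ e ∈ M, ∀ f ∈ M, e ≠ f → ∀ v : V, ¬(v ∈ e ∧ v ∈ f)

instance IsEdgeMatching.instDecidable {V : Type*} [Fintype V] [DecidableEq V]
    (G : SimpleGraph V) [DecidableRel G.Adj] (M : Finset (Sym2 V)) :
    Decidable (IsEdgeMatching G M) := by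
  unfold IsEdgeMatching
  infer_instance

/-- The set `𝓜(G)` of all matchings of `G`, the empty one included. -/
def matchings {V : Type*} [Fintype V] [DecidableEq V] (G : SimpleGraph V)
    [DecidableRel G.Adj] : Finset (Finset (Sym2 V)) :=
  Finset.univ.filter fun M => IsEdgeMatching G M

/-- `V(G) \ V(M)`: the vertices that are not an endpoint of any edge in `M`. -/
def uncovered {V : Type*} [Fintype V] [DecidableEq V] (M : Finset (Sym2 V)) : Finset V :=
  Finset.univ.filter fun v => ∀ e ∈ M, v ∉ e

/-- The Laplacian matching polynomial
`β(G, x) = ∑_{M ∈ 𝓜(G)} (-1)^{|M|} ∏_{v ∈ V(G) \ V(M)} (x - d_G(v))`. -/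
noncomputable def laplacianMatchingPoly {V : Type*} [Fintype V] [DecidableEq V]
    (G : SimpleGraph V) [DecidableRel G.Adj] : Polynomial ℝ :=
  ∑ M ∈ matchings G, (-1) ^ M.card *
    ∏ v ∈ uncovered M, (Polynomial.X - Polynomial.C (G.degree v : ℝ))

/-- The degree sequence of `G`, as a multiset of real numbers (one entry for each vertex). -/
def degreeSequence {V : Type*} [Fintype V] (G : SimpleGraph V) [DecidableRel G.Adj] :
    Multiset ℝ :=
  Finset.univ.val.map fun v : V => (G.degree v : ℝ)

/-- The sum `x_[1] + ⋯ + x_[k]` of the first `k` terms of the nonincreasing rearrangement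
`x_[1] ≥ ⋯ ≥ x_[n]` of a finite real sequence, given as the multiset of its terms. -/
noncomputable def sumLargest (x : Multiset ℝ) (k : ℕ) : ℝ :=
  ((x.sort (· ≥ ·)).take k).sum

/-- `y` weakly majorizes `x`, for real sequences `x`, `y` of equal length `n`. -/
def WeaklyMajorizes (y x : Multiset ℝ) : Prop :=
  y.card = x.card ∧ ∀ k : ℕ, 1 ≤ k → k ≤ x.card → sumLargest x k ≤ sumLargest y k

/-- `y` majorizes `x`: `y` weakly majorizes `x` and the total sums agree. -/
def Majorizes (y x : Multiset ℝ) : Prop :=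
  WeaklyMajorizes y x ∧ x.sum = y.sum

/-! Fix vertex weights `a` and let P(S) be the weighted matching polynomial of the subgraph induced
on S. Deleting vertices leaves the weights unchanged, and degree weights on S = V give β. The
recurrence P(S) = (X - a v) P(S - v) - ∑_{u ∼ v} P(S - v - u) has the shape of an arrow determinant.
Suppose P(S - v) = ∏ (X - θ i) and the subtracted sum is ∑ c i ∏_{j ≠ i} (X - θ j) with c ≥ 0. Then
P(S) is the characteristic polynomial of a real symmetric matrix with diagonal (a v, θ) and border
√c: its roots are real and, by Schur, majorize that diagonal. Moreover P(S - v) is a diagonal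
cofactor, hence a nonnegative combination of the products ∏_{j ≠ i} (X - z j) over the new roots z,
and the induction in `matchingPolyOn_roots` continues. Majorization is carried as ∑ (x - τ)⁺ ≤ ∑ (z
- τ)⁺ for all τ, which is additive in the entries. -/

/-! ### Majorization through threshold sums. -/

theorem Multiset.sort_take_le_drop (s : Multiset ℝ) {k : ℕ} (hk : 1 ≤ k) (hks : k ≤ s.card) :
    ∃ τ : ℝ, (∀ x ∈ (s.sort (· ≥ ·)).take k, τ ≤ x) ∧ ∀ x ∈ (s.sort (· ≥ ·)).drop k, x ≤ τ := by
  have hlen : (s.sort (· ≥ ·)).length = s.card := s.length_sort _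
  have hs : (s.sort (· ≥ ·)).Pairwise (· ≥ ·) := s.pairwise_sort _
  generalize s.sort (· ≥ ·) = l at hlen hs
  rw [List.pairwise_iff_getElem] at hs
  have hlt : k - 1 < l.length := by omega
  refine ⟨l[k - 1], fun x hx => ?_, fun x hx => ?_⟩
  · obtain ⟨i, hi, rfl⟩ := List.mem_iff_getElem.1 hx
    rw [List.length_take] at hi
    rw [List.getElem_take]
    rcases (show i ≤ k - 1 by omega).eq_or_lt with h | h
    · subst h; exact le_rfl
    · exact hs _ _ _ _ h
  · obtain ⟨i, hi, rfl⟩ := List.mem_iff_getElem.1 hx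
    rw [List.length_drop] at hi
    rw [List.getElem_drop]
    exact hs _ _ _ _ (by omega)

theorem List.sum_le_length_mul_add_sum_max (l : List ℝ) (τ : ℝ) :
    l.sum ≤ l.length * τ + (l.map fun x => max (x - τ) 0).sum := by
  induction l with
  | nil => simp
  | cons x l ih =>
    have := le_max_left (x - τ) 0
    simp only [List.sum_cons, List.length_cons, List.map_cons, Nat.cast_succ]
    linarith

theorem List.sum_eq_length_mul_add_sum_max (l : List ℝ) (τ : ℝ) (h : ∀ x ∈ l, τ ≤ x) :
    l.sum = l.length * τ + (l.map fun x => max (x - τ) 0).sum := by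
  induction l with
  | nil => simp
  | cons x l ih =>
    have h1 := max_eq_left (sub_nonneg.2 (h x (by simp)))
    have h2 := ih fun y hy => h y (by simp [hy])
    simp only [List.sum_cons, List.length_cons, List.map_cons, Nat.cast_succ, h1]
    linarith

theorem Multiset.sum_max_eq_take_add_drop (s : Multiset ℝ) (k : ℕ) (τ : ℝ) :
    (s.map fun x => max (x - τ) 0).sum =
      (((s.sort (· ≥ ·)).take k).map fun x => max (x - τ) 0).sum +
        (((s.sort (· ≥ ·)).drop k).map fun x => max (x - τ) 0).sum := by
  conv_lhs => rw [← Multiset.sort_eq s (· ≥ ·), Multiset.map_coe, Multiset.sum_coe,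
    ← List.take_append_drop k (s.sort (· ≥ ·)), List.map_append, List.sum_append]

theorem sumLargest_le (s : Multiset ℝ) {k : ℕ} (hks : k ≤ s.card) (τ : ℝ) :
    sumLargest s k ≤ k * τ + (s.map fun x => max (x - τ) 0).sum := by
  have h := List.sum_le_length_mul_add_sum_max ((s.sort (· ≥ ·)).take k) τ
  rw [List.length_take, Multiset.length_sort, min_eq_left hks] at h
  have h2 : 0 ≤ (((s.sort (· ≥ ·)).drop k).map fun x => max (x - τ) 0).sum :=
    List.sum_nonneg fun y hy => by
      obtain ⟨x, _, rfl⟩ := List.mem_map.1 hy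
      exact le_max_right _ _
  rw [s.sum_max_eq_take_add_drop k]
  unfold sumLargest
  linarith

/-- The upper bound of `sumLargest_le` is attained when τ is the k-th largest term: nothing is lost
on the first k terms, and the others contribute zero. -/
theorem exists_sumLargest_eq (s : Multiset ℝ) {k : ℕ} (hk : 1 ≤ k) (hks : k ≤ s.card) :
    ∃ τ : ℝ, sumLargest s k = k * τ + (s.map fun x => max (x - τ) 0).sum := by
  obtain ⟨τ, h1, h2⟩ := s.sort_take_le_drop hk hks
  refine ⟨τ, ?_⟩
  have h := List.sum_eq_length_mul_add_sum_max _ τ h1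
  rw [List.length_take, Multiset.length_sort, min_eq_left hks] at h
  have h3 : (((s.sort (· ≥ ·)).drop k).map fun x => max (x - τ) 0).sum = 0 := by
    refine List.sum_eq_zero fun y hy => ?_
    obtain ⟨x, hx, rfl⟩ := List.mem_map.1 hy
    exact max_eq_right (sub_nonpos.2 (h2 x hx))
  rw [s.sum_max_eq_take_add_drop k, h3, add_zero]
  exact h

/-- The Hardy–Littlewood–Pólya criterion: `y` majorizes `x` as soon as the sums agree and
`∑ (x_i - τ)⁺ ≤ ∑ (y_i - τ)⁺` for every threshold `τ`. -/
theorem majorizes_of_sum_max_le {x y : Multiset ℝ} (hcard : y.card = x.card)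
    (hsum : x.sum = y.sum)
    (h : ∀ τ : ℝ, (x.map fun z => max (z - τ) 0).sum ≤ (y.map fun z => max (z - τ) 0).sum) :
    Majorizes y x := by
  refine ⟨⟨hcard, fun k hk hkx => ?_⟩, hsum⟩
  obtain ⟨τ, hτ⟩ := exists_sumLargest_eq y hk (hcard ▸ hkx)
  rw [hτ]
  linarith [sumLargest_le x hkx τ, h τ]

/-! ### Symmetric matrices and arrow determinants. -/

open Polynomial Matrix in
-- The adjugate reverses products, and P * Q = 1 gives adj P = det P • Q and adj Q = det Q • P with
-- det P * det Q = 1.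
theorem Matrix.adjugate_conj {m R : Type*} [Fintype m] [DecidableEq m] [CommRing R]
    (P D Q : Matrix m m R) (h : P * Q = 1) : (P * D * Q).adjugate = P * D.adjugate * Q := by
  have hdet : P.det * Q.det = 1 := by rw [← det_mul, h, det_one]
  have hP : P.adjugate = P.det • Q := by
    rw [← mul_one P.adjugate, ← h, ← mul_assoc, adjugate_mul, smul_mul_assoc, one_mul]
  have hQ : Q.adjugate = Q.det • P := by
    rw [← one_mul Q.adjugate, ← h, mul_assoc, mul_adjugate, mul_smul_comm, mul_one]
  rw [adjugate_mul_distrib, adjugate_mul_distrib, hP, hQ]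
  simp only [smul_mul_assoc, mul_smul_comm, smul_smul, ← mul_assoc]
  rw [hdet, one_smul]

open Polynomial Matrix in
/-- The diagonal entries of the adjugate of `X - A`, for a real symmetric matrix `A` with
eigenvector matrix `U`. -/
theorem Matrix.IsHermitian.adjugate_charmatrix_apply {m : Type*} [Fintype m] [DecidableEq m]
    {A : Matrix m m ℝ} (hA : A.IsHermitian) (i : m) :
    (charmatrix A).adjugate i i = ∑ j, C ((hA.eigenvectorUnitary : Matrix m m ℝ) i j ^ 2) *
      ∏ k ∈ Finset.univ.erase j, (X - C (hA.eigenvalues k)) := by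
  set U := (hA.eigenvectorUnitary : Matrix m m ℝ) with hU
  have hUU : U * star U = 1 := Unitary.coe_mul_star_self hA.eigenvectorUnitary
  have hs : A = U * diagonal hA.eigenvalues * star U := by
    have := hA.spectral_theorem
    rw [Unitary.conjStarAlgAut_apply] at this
    simpa using this
  have hUU' : U.map C * (star U).map C = (1 : Matrix m m ℝ[X]) := by
    rw [← Matrix.map_mul, hUU]
    simp
  have hc : charmatrix A =
      U.map C * diagonal (fun k => X - C (hA.eigenvalues k)) * (star U).map C := by
    have hd : diagonal (fun k => X - C (hA.eigenvalues k)) =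
        (X : ℝ[X]) • (1 : Matrix m m ℝ[X]) - (diagonal hA.eigenvalues).map C := by
      rw [diagonal_map (by simp), ← diagonal_one, ← diagonal_smul, diagonal_sub]
      simp
    have hm : A.map C = U.map C * (diagonal hA.eigenvalues).map C * (star U).map C := by
      conv_lhs => rw [hs, Matrix.map_mul, Matrix.map_mul]
    rw [hd, mul_sub, sub_mul, ← hm, mul_smul_comm, mul_one, smul_mul_assoc, hUU']
    ext a b
    simp [charmatrix_apply, Matrix.one_apply, Matrix.diagonal_apply]
  rw [hc, adjugate_conj _ _ _ hUU', adjugate_diagonal, mul_apply]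
  refine Finset.sum_congr rfl fun j _ => ?_
  rw [mul_diagonal]
  simp only [map_apply, star_apply, star_trivial, C_pow]
  ring

open Matrix in
-- Schur complement of the diagonal block, which is invertible since no `d i` vanishes.
theorem Matrix.det_arrow_of_field {ι K : Type*} [Fintype ι] [DecidableEq ι] [Field K] (a : K)
    (u v d : ι → K) (hd : ∀ i, d i ≠ 0) :
    (fromBlocks (of fun _ _ : Unit => a) (of fun _ i => u i) (of fun i _ => v i)
      (diagonal d)).det = a * ∏ i, d i - ∑ i, u i * v i * ∏ j ∈ Finset.univ.erase i, d j := by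
  have hdet : (diagonal d).det ≠ 0 := by
    rw [det_diagonal]
    exact Finset.prod_ne_zero_iff.2 fun i _ => hd i
  have : Invertible (diagonal d) := invertibleOfIsUnitDet _ (isUnit_iff_ne_zero.2 hdet)
  have hinv : ⅟(diagonal d) = diagonal fun i => (d i)⁻¹ := by
    refine invOf_eq_right_inv ?_
    rw [diagonal_mul_diagonal, ← diagonal_one]
    congr 1
    ext i
    exact mul_inv_cancel₀ (hd i)
  rw [det_fromBlocks₂₂, hinv, det_diagonal, det_unique (n := Unit)]
  rw [sub_apply, of_apply, mul_apply]
  simp only [mul_diagonal, of_apply]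
  rw [mul_sub, mul_comm, Finset.mul_sum]
  congr 1
  refine Finset.sum_congr rfl fun i _ => ?_
  rw [← Finset.mul_prod_erase _ _ (Finset.mem_univ i)]
  field_simp [hd i]

open Polynomial Matrix in
/-- The characteristic matrix of an arrow matrix. -/
theorem Matrix.det_arrow_X_sub_C {ι : Type*} [Fintype ι] [DecidableEq ι] (a : ℝ[X])
    (u v : ι → ℝ[X]) (θ : ι → ℝ) :
    (fromBlocks (of fun _ _ : Unit => a) (of fun _ i => u i) (of fun i _ => v i)
      (diagonal fun i => X - C (θ i))).det =
      a * ∏ i, (X - C (θ i)) - ∑ i, u i * v i * ∏ j ∈ Finset.univ.erase i, (X - C (θ j)) := by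
  -- Over the field of fractions the entries X - θ i are nonzero, even where θ has repetitions.
  apply IsFractionRing.injective ℝ[X] (FractionRing ℝ[X])
  rw [RingHom.map_det, RingHom.mapMatrix_apply, fromBlocks_map, diagonal_map (map_zero _)]
  have := det_arrow_of_field (algebraMap ℝ[X] (FractionRing ℝ[X]) a)
    (fun i => algebraMap ℝ[X] (FractionRing ℝ[X]) (u i))
    (fun i => algebraMap ℝ[X] (FractionRing ℝ[X]) (v i))
    (fun i => algebraMap ℝ[X] (FractionRing ℝ[X]) (X - C (θ i))) fun i => by
      rw [Ne, FaithfulSMul.algebraMap_eq_zero_iff]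
      exact X_sub_C_ne_zero _
  simp only [map_sub, map_mul, map_sum, map_prod] at this ⊢
  rw [← this]
  rfl

open Matrix in
/-- The easy half of the Schur–Horn theorem. -/
theorem Matrix.IsHermitian.sum_max_diag_le {m : Type*} [Fintype m] [DecidableEq m]
    {A : Matrix m m ℝ} (hA : A.IsHermitian) (τ : ℝ) :
    ∑ i, max (A i i - τ) 0 ≤ ∑ j, max (hA.eigenvalues j - τ) 0 := by
  set U := (hA.eigenvectorUnitary : Matrix m m ℝ) with hU
  have hUU : U * star U = 1 := Unitary.coe_mul_star_self hA.eigenvectorUnitary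
  have hUU' : star U * U = 1 := Unitary.coe_star_mul_self hA.eigenvectorUnitary
  have hs : A = U * diagonal hA.eigenvalues * star U := by
    have := hA.spectral_theorem
    rw [Unitary.conjStarAlgAut_apply] at this
    simpa using this
  have hrow : ∀ i, ∑ j, U i j ^ 2 = 1 := fun i => by
    have := congrFun (congrFun hUU i) i
    simpa [mul_apply, sq] using this
  have hcol : ∀ j, ∑ i, U i j ^ 2 = 1 := fun j => by
    have := congrFun (congrFun hUU' j) j
    simpa [mul_apply, sq] using this
  have hdiag : ∀ i, A i i = ∑ j, U i j ^ 2 * hA.eigenvalues j := fun i => by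
    conv_lhs => rw [hs, mul_apply]
    refine Finset.sum_congr rfl fun j _ => ?_
    rw [mul_diagonal, star_apply, star_trivial]
    ring
  -- The squares `U i j ^ 2` form a doubly stochastic matrix, so each diagonal entry is an average
  -- of eigenvalues. Jensen applies to the convex function t ↦ (t - τ)⁺.
  calc ∑ i, max (A i i - τ) 0
      ≤ ∑ i, ∑ j, U i j ^ 2 * max (hA.eigenvalues j - τ) 0 := by
        refine Finset.sum_le_sum fun i _ => max_le ?_ ?_
        · have : A i i - τ = ∑ j, U i j ^ 2 * (hA.eigenvalues j - τ) := by
            simp only [mul_sub, Finset.sum_sub_distrib, ← Finset.sum_mul, hrow, hdiag i, one_mul]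
          rw [this]
          exact Finset.sum_le_sum fun j _ =>
            mul_le_mul_of_nonneg_left (le_max_left _ _) (sq_nonneg _)
        · exact Finset.sum_nonneg fun j _ => mul_nonneg (sq_nonneg _) (le_max_right _ _)
    _ = ∑ j, max (hA.eigenvalues j - τ) 0 := by
        rw [Finset.sum_comm]
        simp only [← Finset.sum_mul, hcol, one_mul]

open Polynomial Matrix in
/-- Bordering a diagonal matrix: if `c ≥ 0`, then `(X - a) ∏ (X - θ i) - ∑ c i ∏_{j ≠ i} (X - θ j)`
is real-rooted, and its roots interlace and majorize in the expected way. -/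
theorem exists_roots_bordered {ι : Type*} [Fintype ι] [DecidableEq ι] (a : ℝ) (θ c : ι → ℝ)
    (hc : ∀ i, 0 ≤ c i) :
    ∃ (z u : Unit ⊕ ι → ℝ), (∀ i, 0 ≤ u i) ∧
      (X - C a) * ∏ i, (X - C (θ i)) -
        ∑ i, C (c i) * ∏ j ∈ Finset.univ.erase i, (X - C (θ j)) = ∏ i, (X - C (z i)) ∧
      ∏ i, (X - C (θ i)) = ∑ i, C (u i) * ∏ j ∈ Finset.univ.erase i, (X - C (z j)) ∧
      a + ∑ i, θ i = ∑ i, z i ∧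
      ∀ τ, max (a - τ) 0 + ∑ i, max (θ i - τ) 0 ≤ ∑ i, max (z i - τ) 0 := by
  set A : Matrix (Unit ⊕ ι) (Unit ⊕ ι) ℝ :=
    fromBlocks (of fun _ _ : Unit => a) (of fun _ i => √(c i)) (of fun i _ => √(c i))
      (diagonal θ) with hAdef
  have hA : A.IsHermitian := by
    refine IsHermitian.fromBlocks ?_ ?_ ?_
    · ext; simp
    · ext; simp
    · exact isHermitian_diagonal θ
  have hchar : charmatrix A = fromBlocks (of fun _ _ : Unit => X - C a)
      (of fun _ i => -C √(c i)) (of fun i _ => -C √(c i))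
      (diagonal fun i => X - C (θ i)) := by
    rw [hAdef, charmatrix_fromBlocks]
    congr 1
    ext i j : 1
    by_cases h : i = j <;> simp [h]
  -- The coefficients `u` are the squared border coordinates of the orthonormal eigenvectors, as
  -- given by the diagonal entry of the adjugate.
  refine ⟨hA.eigenvalues, fun j => (hA.eigenvectorUnitary : Matrix (Unit ⊕ ι) (Unit ⊕ ι) ℝ) (Sum.inl ()) j ^ 2,
    fun _ => sq_nonneg _, ?_, ?_, ?_, fun τ => ?_⟩
  · have h := hA.charpoly_eq
    rw [charpoly, hchar, det_arrow_X_sub_C] at h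
    refine Eq.trans ?_ h
    congr 1
    refine Finset.sum_congr rfl fun i _ => ?_
    rw [neg_mul_neg, ← C_mul, Real.mul_self_sqrt (hc i)]
  · rw [← hA.adjugate_charmatrix_apply, adjugate_apply, hchar]
    have : (fromBlocks (of fun _ _ : Unit => X - C a) (of fun _ i => -C √(c i))
        (of fun i _ => -C √(c i)) (diagonal fun i => X - C (θ i))).updateRow (Sum.inl ())
          (Pi.single (Sum.inl ()) 1) =
        fromBlocks 1 0 (of fun i _ => -C √(c i)) (diagonal fun i => X - C (θ i)) := by
      ext i j : 1
      rcases i with i | i <;> rcases j with j | j <;> simp [updateRow_apply]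
    rw [this, det_fromBlocks_zero₁₂, det_one, one_mul, det_diagonal]
  · have h := hA.trace_eq_sum_eigenvalues
    simpa [hAdef, trace] using h
  · have h := hA.sum_max_diag_le τ
    simpa [hAdef] using h

/-! ### Weighted matching polynomials and the vertex recurrence. -/

/-- The matchings of `G` all of whose edges lie within the vertex set `S`. -/
def matchingsWithin {V : Type*} [Fintype V] [DecidableEq V] (G : SimpleGraph V)
    [DecidableRel G.Adj] (S : Finset V) : Finset (Finset (Sym2 V)) :=
  (matchings G).filter fun M => ∀ e ∈ M, ∀ v : V, v ∈ e → v ∈ S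

open Polynomial in
/-- The matching polynomial, with vertex weights `a`, of the subgraph of `G` induced on `S`. -/
noncomputable def matchingPolyOn {V : Type*} [Fintype V] [DecidableEq V] (G : SimpleGraph V)
    [DecidableRel G.Adj] (a : V → ℝ) (S : Finset V) : ℝ[X] :=
  ∑ M ∈ matchingsWithin G S, (-1) ^ M.card * ∏ v ∈ S ∩ uncovered M, (X - C (a v))

section

variable {V : Type*} [Fintype V] [DecidableEq V] {G : SimpleGraph V} [DecidableRel G.Adj]

theorem mem_matchingsWithin {S : Finset V} {M : Finset (Sym2 V)} :
    M ∈ matchingsWithin G S ↔ IsEdgeMatching G M ∧ ∀ e ∈ M, ∀ v : V, v ∈ e → v ∈ S := by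
  simp [matchingsWithin, matchings]

theorem mem_uncovered {M : Finset (Sym2 V)} {v : V} : v ∈ uncovered M ↔ ∀ e ∈ M, v ∉ e := by
  simp [uncovered]

theorem filter_mem_uncovered_matchingsWithin (S : Finset V) (v : V) :
    (matchingsWithin G S).filter (fun M => v ∈ uncovered M) = matchingsWithin G (S.erase v) := by
  ext M
  simp only [Finset.mem_filter, mem_matchingsWithin, mem_uncovered, Finset.mem_erase]
  constructor
  · rintro ⟨⟨h1, h2⟩, h3⟩
    exact ⟨h1, fun e he w hw => ⟨fun h => h3 e he (h ▸ hw), h2 e he w hw⟩⟩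
  · rintro ⟨h1, h2⟩
    exact ⟨⟨h1, fun e he w hw => (h2 e he w hw).2⟩, fun e he hv => (h2 e he v hv).1 rfl⟩

theorem matchingsWithin_avoid {S : Finset V} {M : Finset (Sym2 V)} {v : V}
    (hM : M ∈ matchingsWithin G S) (hv : v ∉ S) {e : Sym2 V} (he : e ∈ M) : v ∉ e :=
  fun h => hv ((mem_matchingsWithin.1 hM).2 e he v h)

theorem insert_edge_mem_matchingsWithin {S : Finset V} {v u : V} (hv : v ∈ S) (hu : u ∈ S)
    (h : G.Adj v u) {M : Finset (Sym2 V)} (hM : M ∈ matchingsWithin G ((S.erase v).erase u)) :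
    insert s(v, u) M ∈ matchingsWithin G S := by
  have hvM : ∀ e ∈ M, v ∉ e := fun e he => matchingsWithin_avoid hM (by simp) he
  have huM : ∀ e ∈ M, u ∉ e := fun e he => matchingsWithin_avoid hM (by simp) he
  obtain ⟨⟨h1, h2⟩, h3⟩ := mem_matchingsWithin.1 hM
  refine mem_matchingsWithin.2 ⟨⟨fun e he => ?_, fun e he f hf hef w hw => ?_⟩,
    fun e he w hw => ?_⟩
  · rcases Finset.mem_insert.1 he with rfl | he
    · exact h
    · exact h1 e he
  · rcases Finset.mem_insert.1 he with rfl | heM <;> rcases Finset.mem_insert.1 hf with rfl | hfM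
    · exact hef rfl
    · rcases Sym2.mem_iff.1 hw.1 with rfl | rfl
      · exact hvM f hfM hw.2
      · exact huM f hfM hw.2
    · rcases Sym2.mem_iff.1 hw.2 with rfl | rfl
      · exact hvM e heM hw.1
      · exact huM e heM hw.1
    · exact h2 e heM f hfM hef w hw
  · rcases Finset.mem_insert.1 he with rfl | he
    · rcases Sym2.mem_iff.1 hw with rfl | rfl <;> assumption
    · exact Finset.mem_of_mem_erase (Finset.mem_of_mem_erase (h3 e he w hw))

theorem erase_edge_mem_matchingsWithin {S : Finset V} {v u : V} {M : Finset (Sym2 V)}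
    (hM : M ∈ matchingsWithin G S) (he : s(v, u) ∈ M) :
    M.erase s(v, u) ∈ matchingsWithin G ((S.erase v).erase u) := by
  obtain ⟨⟨h1, h2⟩, h3⟩ := mem_matchingsWithin.1 hM
  refine mem_matchingsWithin.2 ⟨⟨fun e he => h1 e (Finset.mem_of_mem_erase he),
    fun e he f hf => h2 e (Finset.mem_of_mem_erase he) f (Finset.mem_of_mem_erase hf)⟩,
    fun f hf w hw => ?_⟩
  obtain ⟨hne, hfM⟩ := Finset.mem_erase.1 hf
  refine Finset.mem_erase.2 ⟨?_, Finset.mem_erase.2 ⟨?_, h3 f hfM w hw⟩⟩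
  · rintro rfl
    exact h2 f hfM _ he hne w ⟨hw, Sym2.mem_mk_right v w⟩
  · rintro rfl
    exact h2 f hfM _ he hne w ⟨hw, Sym2.mem_mk_left w u⟩

theorem inter_uncovered_insert_edge (S : Finset V) (v u : V) (M : Finset (Sym2 V)) :
    S ∩ uncovered (insert s(v, u) M) = (S.erase v).erase u ∩ uncovered M := by
  ext w
  simp only [Finset.mem_inter, mem_uncovered, Finset.mem_erase, Finset.forall_mem_insert,
    Sym2.mem_iff, not_or]
  tauto

open Polynomial in
theorem matchingPolyOn_empty (a : V → ℝ) : matchingPolyOn G a ∅ = 1 := by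
  have : matchingsWithin G ∅ = {∅} := by
    ext M
    rw [mem_matchingsWithin, Finset.mem_singleton]
    constructor
    · rintro ⟨-, h⟩
      refine Finset.eq_empty_of_forall_notMem fun e he => ?_
      induction e with
      | _ x y => exact absurd (h _ he x (Sym2.mem_mk_left x y)) (Finset.notMem_empty x)
    · rintro rfl
      exact ⟨⟨by simp, by simp⟩, by simp⟩
  simp [matchingPolyOn, this]

open Polynomial in
/-- The vertex recurrence of the matching polynomial. -/
theorem matchingPolyOn_eq_sub (a : V → ℝ) {S : Finset V} {v : V} (hv : v ∈ S) :
    matchingPolyOn G a S = (X - C (a v)) * matchingPolyOn G a (S.erase v) -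
      ∑ u ∈ (S.erase v).filter (G.Adj v), matchingPolyOn G a ((S.erase v).erase u) := by
  rw [matchingPolyOn, ← Finset.sum_filter_add_sum_filter_not _ (fun M => v ∈ uncovered M),
    filter_mem_uncovered_matchingsWithin, sub_eq_add_neg]
  congr 1
  · rw [matchingPolyOn, Finset.mul_sum]
    refine Finset.sum_congr rfl fun M hM => ?_
    have hvM : v ∈ uncovered M :=
      mem_uncovered.2 fun e he => matchingsWithin_avoid hM (by simp) he
    have : S ∩ uncovered M = insert v (S.erase v ∩ uncovered M) := by
      rw [← Finset.insert_inter_of_mem hvM, Finset.insert_erase hv]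
    rw [this, Finset.prod_insert (by simp)]
    ring
  · simp only [matchingPolyOn]
    rw [← Finset.sum_neg_distrib]
    simp only [← Finset.sum_neg_distrib]
    rw [Finset.sum_sigma']
    symm
    -- A matching covering v is an edge vu together with a matching avoiding both ends; the extra
    -- edge accounts for the sign.
    refine Finset.sum_bij (fun p _ => insert s(v, p.1) p.2) ?_ ?_ ?_ ?_
    · rintro ⟨u, M⟩ h
      simp only [Finset.mem_sigma, Finset.mem_filter] at h
      refine Finset.mem_filter.2
        ⟨insert_edge_mem_matchingsWithin hv (Finset.mem_of_mem_erase h.1.1) h.1.2 h.2, ?_⟩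
      simp [mem_uncovered]
    · rintro ⟨u, M⟩ h ⟨u', M'⟩ h' heq
      simp only [Finset.mem_sigma, Finset.mem_filter] at h h'
      dsimp only at heq
      have hM : ∀ e ∈ M, v ∉ e := fun e he => matchingsWithin_avoid h.2 (by simp) he
      have hM' : ∀ e ∈ M', v ∉ e := fun e he => matchingsWithin_avoid h'.2 (by simp) he
      have hin : s(v, u) ∈ insert s(v, u') M' := heq ▸ Finset.mem_insert_self _ _
      rcases Finset.mem_insert.1 hin with h1 | h1
      · obtain rfl := Sym2.congr_right.1 h1
        have : M = M' := by
          rw [← Finset.erase_insert (fun h => hM _ h (Sym2.mem_mk_left v u)), heq,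
            Finset.erase_insert (fun h => hM' _ h (Sym2.mem_mk_left v u))]
        rw [this]
      · exact absurd (Sym2.mem_mk_left v u) (hM' _ h1)
    · intro M hM
      obtain ⟨hM, hvM⟩ := Finset.mem_filter.1 hM
      rw [mem_uncovered] at hvM
      push Not at hvM
      obtain ⟨e, he, hve⟩ := hvM
      obtain ⟨u, rfl⟩ := Sym2.mem_iff_exists.1 hve
      obtain ⟨⟨h1, -⟩, h3⟩ := mem_matchingsWithin.1 hM
      have hadj : G.Adj v u := h1 _ he
      refine ⟨⟨u, M.erase s(v, u)⟩, ?_, Finset.insert_erase he⟩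
      simp only [Finset.mem_sigma, Finset.mem_filter, Finset.mem_erase]
      exact ⟨⟨⟨hadj.ne', h3 _ he u (Sym2.mem_mk_right v u)⟩, hadj⟩,
        erase_edge_mem_matchingsWithin hM he⟩
    · rintro ⟨u, M⟩ h
      simp only [Finset.mem_sigma, Finset.mem_filter] at h
      have hM : s(v, u) ∉ M := fun he =>
        matchingsWithin_avoid h.2 (by simp) he (Sym2.mem_mk_left v u)
      dsimp only
      rw [inter_uncovered_insert_edge, Finset.card_insert_of_notMem hM, pow_succ]
      ring

theorem matchingPolyOn_univ :
    matchingPolyOn G (fun v => (G.degree v : ℝ)) Finset.univ = laplacianMatchingPoly G := by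
  have : matchingsWithin G Finset.univ = matchings G := by
    simp [matchingsWithin]
  simp [matchingPolyOn, laplacianMatchingPoly, this]

end

/-! ### The interlacing cone and the induction on vertex sets. -/

open Polynomial in
/-- The nonnegative combinations of the polynomials `∏_{j ≠ i} (X - z_j)`, for `z_i` in the
multiset `s`. -/
noncomputable def interlacingCone (s : Multiset ℝ) : AddSubmonoid ℝ[X] :=
  AddSubmonoid.closure {p | ∃ z ∈ s, ∃ c : ℝ, 0 ≤ c ∧
    p = C c * ((s.erase z).map fun y => X - C y).prod}

open Polynomial in
theorem prod_erase_map_univ {ι : Type*} [Fintype ι] [DecidableEq ι] (z : ι → ℝ) (i : ι) :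
    (((Finset.univ.val.map z).erase (z i)).map fun y => X - C y).prod =
      ∏ j ∈ Finset.univ.erase i, (X - C (z j)) := by
  rw [← Multiset.map_erase_of_mem _ _ (Finset.mem_univ_val i), Multiset.map_map]
  rfl

open Polynomial in
-- Links the cone, which depends only on the multiset of roots, to the indexed form used for
-- matrices.
theorem mem_interlacingCone_map_iff {ι : Type*} [Fintype ι] [DecidableEq ι] (z : ι → ℝ)
    (p : ℝ[X]) : p ∈ interlacingCone (Finset.univ.val.map z) ↔ ∃ c : ι → ℝ, (∀ i, 0 ≤ c i) ∧
      p = ∑ i, C (c i) * ∏ j ∈ Finset.univ.erase i, (X - C (z j)) := by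
  constructor
  · intro hp
    induction hp using AddSubmonoid.closure_induction with
    | mem p hp =>
      obtain ⟨y, hy, c, hc, rfl⟩ := hp
      obtain ⟨i, -, rfl⟩ := Multiset.mem_map.1 hy
      refine ⟨Pi.single i c, fun j => ?_, ?_⟩
      · rcases eq_or_ne j i with rfl | h
        · simpa using hc
        · simp [h]
      · rw [Finset.sum_eq_single i (fun j _ h => by simp [h]) (by simp), prod_erase_map_univ]
        simp
    | zero => exact ⟨0, by simp, by simp⟩
    | add p q _ _ hp hq =>
      obtain ⟨c, hc, rfl⟩ := hp
      obtain ⟨d, hd, rfl⟩ := hq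
      refine ⟨c + d, fun i => add_nonneg (hc i) (hd i), ?_⟩
      simp [add_mul, Finset.sum_add_distrib]
  · rintro ⟨c, hc, rfl⟩
    refine AddSubmonoid.sum_mem _ fun i _ => AddSubmonoid.subset_closure ?_
    exact ⟨z i, Multiset.mem_map_of_mem z (Finset.mem_univ_val i), c i, hc i, by
      rw [prod_erase_map_univ]⟩

open Polynomial in
/-- If `r` is in the interlacing cone of `s`, then `(X - a) ∏_{θ ∈ s} (X - θ) - r` is real-rooted,
its interlacing cone contains `∏_{θ ∈ s} (X - θ)`, and its roots majorize `a ::ₘ s`. -/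
theorem exists_roots_sub_of_mem_interlacingCone (a : ℝ) (s : Multiset ℝ) {r : ℝ[X]}
    (hr : r ∈ interlacingCone s) :
    ∃ t : Multiset ℝ,
      (X - C a) * (s.map fun y => X - C y).prod - r = (t.map fun y => X - C y).prod ∧
      (s.map fun y => X - C y).prod ∈ interlacingCone t ∧
      t.card = s.card + 1 ∧ a + s.sum = t.sum ∧
      ∀ τ, max (a - τ) 0 + (s.map fun y => max (y - τ) 0).sum ≤
        (t.map fun y => max (y - τ) 0).sum := by
  obtain ⟨n, θ, rfl⟩ : ∃ (n : ℕ) (θ : Fin n → ℝ), Finset.univ.val.map θ = s := by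
    refine ⟨s.toList.length, s.toList.get, ?_⟩
    conv_rhs => rw [← s.coe_toList]
    rw [Fin.univ_val_map, List.ofFn_get]
  obtain ⟨c, hc, rfl⟩ := (mem_interlacingCone_map_iff θ r).1 hr
  obtain ⟨z, u, hu, h1, h2, h3, h4⟩ := exists_roots_bordered a θ c hc
  refine ⟨Finset.univ.val.map z, ?_, ?_, ?_, ?_, fun τ => ?_⟩
  · simp only [Multiset.map_map]
    exact h1
  · rw [mem_interlacingCone_map_iff]
    exact ⟨u, hu, by simp only [Multiset.map_map]; exact h2⟩
  · simp [add_comm]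
  · exact h3
  · simp only [Multiset.map_map]
    exact h4 τ

open Polynomial in
-- Cone membership for every v in S is the strengthening that makes the induction work: cones are
-- closed under addition, so the sum over neighbours is admissible at the next step.
theorem matchingPolyOn_roots {V : Type*} [Fintype V] [DecidableEq V] (G : SimpleGraph V)
    [DecidableRel G.Adj] (a : V → ℝ) (S : Finset V) :
    ∃ s : Multiset ℝ, matchingPolyOn G a S = (s.map fun y => X - C y).prod ∧
      s.card = S.card ∧ ∑ v ∈ S, a v = s.sum ∧
      (∀ τ, ∑ v ∈ S, max (a v - τ) 0 ≤ (s.map fun y => max (y - τ) 0).sum) ∧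
      ∀ v ∈ S, matchingPolyOn G a (S.erase v) ∈ interlacingCone s := by
  induction S using Finset.strongInduction with
  | H S ih =>
    have key : ∀ v ∈ S, ∃ s : Multiset ℝ, matchingPolyOn G a S = (s.map fun y => X - C y).prod ∧
        s.card = S.card ∧ ∑ v ∈ S, a v = s.sum ∧
        (∀ τ, ∑ v ∈ S, max (a v - τ) 0 ≤ (s.map fun y => max (y - τ) 0).sum) ∧
        matchingPolyOn G a (S.erase v) ∈ interlacingCone s := by
      intro v hv
      obtain ⟨s, h1, h2, h3, h4, h5⟩ := ih _ (Finset.erase_ssubset hv)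
      have hr : ∑ u ∈ (S.erase v).filter (G.Adj v), matchingPolyOn G a ((S.erase v).erase u) ∈
          interlacingCone s :=
        AddSubmonoid.sum_mem _ fun u hu => h5 u (Finset.mem_filter.1 hu).1
      obtain ⟨t, k1, k2, k3, k4, k5⟩ := exists_roots_sub_of_mem_interlacingCone (a v) s hr
      refine ⟨t, ?_, ?_, ?_, fun τ => ?_, h1 ▸ k2⟩
      · rw [matchingPolyOn_eq_sub a hv, h1, k1]
      · rw [k3, h2, Finset.card_erase_add_one hv]
      · rw [← k4, ← h3, Finset.add_sum_erase S a hv]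
      · rw [← Finset.add_sum_erase S (fun v => max (a v - τ) 0) hv]
        exact (add_le_add_right (h4 τ) _).trans (k5 τ)
    rcases S.eq_empty_or_nonempty with rfl | ⟨v₀, hv₀⟩
    · exact ⟨0, by simp [matchingPolyOn_empty], by simp, by simp, by simp, by simp⟩
    · obtain ⟨s, h1, h2, h3, h4, -⟩ := key v₀ hv₀
      refine ⟨s, h1, h2, h3, h4, fun v hv => ?_⟩
      obtain ⟨t, k1, -, -, -, k5⟩ := key v hv
      -- The matrix depends on the chosen vertex, but its spectrum does not: both multisets are the
      -- roots of P(S).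
      have : s = t := by
        rw [← roots_multiset_prod_X_sub_C s, ← h1, k1, roots_multiset_prod_X_sub_C]
      rwa [this]

/-- For every finite simple graph, all zeros of the Laplacian matching polynomial are real, and the
sequence of its zeros, counted with multiplicity, majorizes the degree sequence. -/
theorem theorem3p5 {V : Type*} [Fintype V] [DecidableEq V] (G : SimpleGraph V)
    [DecidableRel G.Adj] :
    (laplacianMatchingPoly G).Splits ∧
      Majorizes (laplacianMatchingPoly G).roots (degreeSequence G) := by
  obtain ⟨s, h1, h2, h3, h4, -⟩ :=
    matchingPolyOn_roots G (fun v => (G.degree v : ℝ)) Finset.univ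
  rw [matchingPolyOn_univ] at h1
  rw [h1, Polynomial.roots_multiset_prod_X_sub_C]
  refine ⟨Polynomial.Splits.multisetProd fun p hp => ?_, majorizes_of_sum_max_le ?_ ?_ fun τ => ?_⟩
  · obtain ⟨y, -, rfl⟩ := Multiset.mem_map.1 hp
    exact Polynomial.Splits.X_sub_C y
  · simpa [degreeSequence] using h2
  · exact h3
  · simp only [degreeSequence, Multiset.map_map]
    exact h4 τ
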